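/- Let $\beta$ be an $n$-strand braid, given by any word in the Artin generators $\sigma_1^{\pm1},\dots,\sigma_{n-1}^{\pm1}$, and let $CKh(\bar\beta)$ be the Khovanov chain complex with $\mathbb Z/2$ coefficients, with differential $d$, of the resulting diagram of the braid closure $\bar\beta$ in the annulus. It is spanned by the canonical generators: complete resolutions with each circle labeled $v_+$ or $v_-$. For a canonical generator $x$ let $k(x)$ be the number of $v_+$-labeled minus the number of $v_-$-labeled non-trivial circles, a circle being non-trivial if its mod 2 intersection number with an arc joining the two boundary components of the annulus is $1$. Let $\mathcal F_i$ be the span of the canonical generators with $k\le i$; the $\mathcal F_i$ form a bounded filtration of $CKh(\bar\beta)$ by subcomplexes, and $E^r_p = \{x\in\mathcal F_p : dx\in\mathcal F_{p-r}\}/(\mathcal F_{p-1}+d\mathcal F_{p+r-1})$ (the denominator being intersected with the numerator), with differentials $d^r:E^r_p\to E^r_{p-r}$, $[x]\mapsto[dx]$, are the pages of the spectral sequence from the annular Khovanov homology $SKh(\bar\beta)=E^1$ to $Kh(\bar\beta)$. Let its length be the largest $r\ge1$ such that $d^r\neq0$ (and $0$ if there is none). Let $\psi(\bar\beta)$ be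 the generator given by the braidlike resolution (the $n$-strand unlink) with all circles labeled $v_-$, and let $$\kappa(\beta)=n+\min\{i : [\psi(\bar\beta)]=0\in H(\mathcal F_i)\},$$ with $\kappa(\beta)=\infty$ if $\psi(\bar\beta)$ is not a boundary in $CKh(\bar\beta)$. If $\kappa(\beta)<\infty$, then the length of the spectral sequence from $SKh(\bar\beta)$ to $Kh(\bar\beta)$ is at least $\kappa(\beta)$. -/

import Mathlib

/-! ### The spectral sequence of a filtered complex -/

section FilteredComplex

variable {R C : Type*} [CommRing R] [AddCommGroup C] [Module R C]

/-- `Z^r_p = {x ∈ F_p : d x ∈ F_{p-r}}`, for an increasing filtration `F` of `(C, d)`. -/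
def pageCycles (d : C →ₗ[R] C) (F : ℤ → Submodule R C) (r : ℕ) (p : ℤ) : Submodule R C :=
  F p ⊓ (F (p - r)).comap d

/-- `F_{p-1} + d(F_{p+r-1})`, the denominator of the page `E^r_p`. -/
def pageBoundaries (d : C →ₗ[R] C) (F : ℤ → Submodule R C) (r : ℕ) (p : ℤ) : Submodule R C :=
  F (p - 1) ⊔ (F (p + r - 1)).map d

/-- The page `E^r_p = {x ∈ F_p : d x ∈ F_{p-r}} / (F_{p-1} + d(F_{p+r-1}))` (the denominator being
intersected with the numerator).  `E^0` is the associated graded complex and `E^1` its homology. -/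
abbrev Page (d : C →ₗ[R] C) (F : ℤ → Submodule R C) (r : ℕ) (p : ℤ) : Type _ :=
  pageCycles d F r p ⧸ (pageBoundaries d F r p).submoduleOf (pageCycles d F r p)

/-- The differential `d^r : E^r_p → E^r_{p-r}`, `[x] ↦ [d x]`, is nonzero for some `p`.
(If `d ∘ d = 0`, the condition `hdx` holds for every `x ∈ Z^r_p`.) -/
def PageDifferentialNonzero (d : C →ₗ[R] C) (F : ℤ → Submodule R C) (r : ℕ) : Prop :=
  ∃ p : ℤ, ∃ x ∈ pageCycles d F r p, ∃ hdx : d x ∈ pageCycles d F r (p - r),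
    (Submodule.Quotient.mk ⟨d x, hdx⟩ : Page d F r (p - r)) ≠ 0

/-- The length of the spectral sequence starting at its page `E^1`: the largest `r ≥ 1` with
`d^r ≠ 0` (and `0` if there is none).  The first page at which it collapses is
`E^{length + 1}`. -/
noncomputable def spectralLength (d : C →ₗ[R] C) (F : ℤ → Submodule R C) : ℕ∞ :=
  ⨆ (r : ℕ) (_ : 1 ≤ r) (_ : PageDifferentialNonzero d F r), (r : ℕ∞)

end FilteredComplex

/-! ### Resolutions of the closure of a braid word -/

/-- Words in the Artin generators of the braid group on `n` strands.  The strand positions are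
`0, …, n - 1`; the letter `(i, true)` is the positive generator crossing the positions `i` and
`i + 1`, and `(i, false)` is its inverse. -/
abbrev BraidWord (n : ℕ) : Type := List (Fin (n - 1) × Bool)

namespace BraidWord

/-- The points of the closed braid diagram at position `j` and level `t`.  The crossing number `t`
lies between the levels `t` and `t + 1`; the last level is glued to level `0` by the closure. -/
abbrev Point {n : ℕ} (w : BraidWord n) : Type := Fin n × Fin (w.length + 1)

/-- The left one of the two positions at the crossing `t`. -/
def left {n : ℕ} (w : BraidWord n) (t : Fin w.length) : Fin n :=
  ⟨(w.get t).1, by have := (w.get t).1.isLt; omega⟩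

/-- The right one of the two positions at the crossing `t`. -/
def right {n : ℕ} (w : BraidWord n) (t : Fin w.length) : Fin n :=
  ⟨(w.get t).1 + 1, by have := (w.get t).1.isLt; omega⟩

/-- A complete resolution: `false` is the 0-resolution and `true` the 1-resolution. -/
abbrev Resolution {n : ℕ} (w : BraidWord n) : Type := Fin w.length → Bool

/-- The resolution all of whose smoothings are braidlike (oriented): the 0-resolution at positive
crossings, the 1-resolution at negative ones. -/
def braidlikeResolution {n : ℕ} (w : BraidWord n) : Resolution w := fun t => !(w.get t).2

/-- The arcs of the resolved diagram.  At a crossing, the braidlike smoothing consists of two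
vertical arcs, the other one of a cap and a cup. -/
inductive Joined {n : ℕ} (w : BraidWord n) (I : Resolution w) : Point w → Point w → Prop
  | closure (j : Fin n) : Joined w I (j, 0) (j, Fin.last w.length)
  | away (t : Fin w.length) (j : Fin n) (hl : j ≠ w.left t) (hr : j ≠ w.right t) :
      Joined w I (j, t.castSucc) (j, t.succ)
  | verticalLeft (t : Fin w.length) (h : I t = w.braidlikeResolution t) :
      Joined w I (w.left t, t.castSucc) (w.left t, t.succ)
  | verticalRight (t : Fin w.length) (h : I t = w.braidlikeResolution t) :
      Joined w I (w.right t, t.castSucc) (w.right t, t.succ)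
  | cap (t : Fin w.length) (h : I t ≠ w.braidlikeResolution t) :
      Joined w I (w.left t, t.castSucc) (w.right t, t.castSucc)
  | cup (t : Fin w.length) (h : I t ≠ w.braidlikeResolution t) :
      Joined w I (w.left t, t.succ) (w.right t, t.succ)

/-- The components (circles) of the resolved diagram: the classes of points for the equivalence
relation generated by `Joined`. -/
abbrev Circle {n : ℕ} (w : BraidWord n) (I : Resolution w) : Type := Quot (Joined w I)

/-- The circle through a point. -/
def circleAt {n : ℕ} (w : BraidWord n) (I : Resolution w) (p : Point w) : Circle w I :=
  Quot.mk _ p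

/-- A circle is non-trivial if its mod 2 intersection number with a curve from the inner to the
outer boundary of the annulus is nonzero.  The curve is the line at level `0`, which meets
the diagram in one point on each of the `n` strands. -/
def Circle.Nontrivial {n : ℕ} {w : BraidWord n} {I : Resolution w} (c : Circle w I) : Prop :=
  Odd (Nat.card {j : Fin n // w.circleAt I (j, 0) = c})

/-! ### The Khovanov complex with its annular filtration -/

/-- The labels `v_+` and `v_-`. -/
inductive Label : Type
  | plus : Label
  | minus : Label

instance : Finite Label :=
  Finite.of_surjective (fun b : Bool => if b then Label.plus else Label.minus)
    (fun l => by cases l <;> [exact ⟨true, rfl⟩; exact ⟨false, rfl⟩])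

/-- `MergeTerm a b c`: the basis vector `v_c` occurs in the product `m(v_a ⊗ v_b)`. -/
inductive MergeTerm : Label → Label → Label → Prop
  | plus_plus : MergeTerm .plus .plus .plus
  | plus_minus : MergeTerm .plus .minus .minus
  | minus_plus : MergeTerm .minus .plus .minus

/-- `SplitTerm a b c`: the basis vector `v_b ⊗ v_c` occurs in the coproduct `Δ(v_a)`. -/
inductive SplitTerm : Label → Label → Label → Prop
  | plus_left : SplitTerm .plus .plus .minus
  | plus_right : SplitTerm .plus .minus .plus
  | minus : SplitTerm .minus .minus .minus

/-- The canonical generators: a resolution with a labeling of its circles. -/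
abbrev Generator {n : ℕ} (w : BraidWord n) : Type := Σ I : Resolution w, Circle w I → Label

noncomputable instance {n : ℕ} (w : BraidWord n) : Fintype (Generator w) := Fintype.ofFinite _

/-- The `k`-grading: the number of non-trivial circles labeled `v_+` minus the number of
non-trivial circles labeled `v_-`. -/
noncomputable def Generator.k {n : ℕ} {w : BraidWord n} (x : Generator w) : ℤ :=
  (Nat.card {c : Circle w x.1 // c.Nontrivial ∧ x.2 c = .plus} : ℤ) -
    (Nat.card {c : Circle w x.1 // c.Nontrivial ∧ x.2 c = .minus} : ℤ)

/-- The circle through the first of the two arcs of the resolution `I` at the crossing `t`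
(the left vertical arc, or the cap). -/
def firstCircle {n : ℕ} (w : BraidWord n) (I : Resolution w) (t : Fin w.length) : Circle w I :=
  w.circleAt I (w.left t, t.castSucc)

/-- The circle through the second of the two arcs of the resolution `I` at the crossing `t`
(the right vertical arc, or the cup). -/
def secondCircle {n : ℕ} (w : BraidWord n) (I : Resolution w) (t : Fin w.length) : Circle w I :=
  if I t = w.braidlikeResolution t then w.circleAt I (w.right t, t.castSucc)
  else w.circleAt I (w.left t, t.succ)

/-- `EdgeTerm t x y`: the generator `y` occurs in the image of `x` under the edge map of the cube
of resolutions that changes the crossing `t` from its 0- to its 1-resolution.  Labels of circles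
away from the crossing are kept.  If the two arcs of `x` at `t` lie on different circles, these are
merged; if they lie on the same circle, it is split. -/
structure EdgeTerm {n : ℕ} {w : BraidWord n} (t : Fin w.length) (x y : Generator w) : Prop where
  source_res : x.1 t = false
  target_res : y.1 = Function.update x.1 t true
  away : ∀ p : Point w, w.circleAt x.1 p ≠ w.firstCircle x.1 t →
    w.circleAt x.1 p ≠ w.secondCircle x.1 t → y.2 (w.circleAt y.1 p) = x.2 (w.circleAt x.1 p)
  merge : w.firstCircle x.1 t ≠ w.secondCircle x.1 t →
    MergeTerm (x.2 (w.firstCircle x.1 t)) (x.2 (w.secondCircle x.1 t)) (y.2 (w.firstCircle y.1 t))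
  split : w.firstCircle x.1 t = w.secondCircle x.1 t →
    SplitTerm (x.2 (w.firstCircle x.1 t)) (y.2 (w.firstCircle y.1 t)) (y.2 (w.secondCircle y.1 t))

/-- The Khovanov chain group of the closed braid diagram, with coefficients in `ℤ/2`. -/
abbrev CKh {n : ℕ} (w : BraidWord n) : Type := Generator w →₀ ZMod 2

open Classical in
/-- The Khovanov differential: the sum of all edge maps of the cube of resolutions. -/
noncomputable def khovanovD {n : ℕ} (w : BraidWord n) : CKh w →ₗ[ZMod 2] CKh w :=
  Finsupp.linearCombination (ZMod 2) fun x : Generator w =>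
    ∑ t : Fin w.length, ∑ y : Generator w, if EdgeTerm t x y then Finsupp.single y 1 else 0

/-- The annular filtration: `F_i` is spanned by the canonical generators of `k`-grading at
most `i`. -/
def annularFiltration {n : ℕ} (w : BraidWord n) (i : ℤ) : Submodule (ZMod 2) (CKh w) :=
  Finsupp.supported (ZMod 2) (ZMod 2) {x : Generator w | x.k ≤ i}

/-- The transverse element `ψ`: every circle of the braidlike resolution is labeled `v_-`. -/
noncomputable def psi {n : ℕ} (w : BraidWord n) : CKh w :=
  Finsupp.single ⟨w.braidlikeResolution, fun _ => .minus⟩ 1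

/-- `κ = n + min {i : [ψ] = 0 in H(F_i)}`, and `κ = ∞` if `ψ` is not a boundary.  It is written
with `m = n + i`; as `ψ` is nonzero of `k`-grading `-n`, only `i ≥ -n` can occur. -/
noncomputable def kappa {n : ℕ} (w : BraidWord n) : ℕ∞ :=
  ⨅ (m : ℕ) (_ : w.psi ∈ (w.annularFiltration ((m : ℤ) - n)).map w.khovanovD), (m : ℕ∞)

/-- The length of the spectral sequence of the Khovanov complex filtered by the `k`-grading, whose
page `E^1` is the annular Khovanov homology and which converges to Khovanov homology. -/
noncomputable def annularLength {n : ℕ} (w : BraidWord n) : ℕ∞ :=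
  spectralLength w.khovanovD w.annularFiltration

end BraidWord

namespace BraidWord

variable {n : ℕ} {w : BraidWord n}

/-! Each non-trivial circle uses up a strand position at level `0`, so `-n` is the lowest possible
`k`-grading and `F_i = 0` for `i < -n`; `ψ` is a cycle in this bottom level. Let `m` be minimal with
`ψ = d y` for some `y ∈ F_{m-n}`. Then `d^m [y] = [ψ]` in `E^m_{-n}`, whose denominator `F_{-n-1} +
d F_{m-1-n}` is just `d F_{m-1-n}`. By minimality of `m` it does not contain `ψ`, so `d^m ≠ 0`. The
main step is `pageDifferentialNonzero_of_psi_mem`. -/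

/-- A non-trivial circle meets the line at level `0`. -/
theorem Circle.Nontrivial.exists_circleAt_eq {I : Resolution w} {c : Circle w I}
    (hc : c.Nontrivial) : ∃ j : Fin n, w.circleAt I (j, 0) = c := by
  obtain ⟨⟨j, hj⟩⟩ := (Nat.card_pos_iff.1 (Odd.pos hc)).1
  exact ⟨j, hj⟩

/-- The `k`-grading is at least `-n`. -/
theorem Generator.neg_le_k (x : Generator w) : -(n : ℤ) ≤ x.k := by
  have h : Nat.card {c : Circle w x.1 // c.Nontrivial ∧ x.2 c = .minus} ≤ n := by
    -- Choosing a level-`0` position on each circle is injective, as a point determines its circle.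
    choose f hf using fun c : {c : Circle w x.1 // c.Nontrivial ∧ x.2 c = .minus} =>
      c.2.1.exists_circleAt_eq
    have hinj : Function.Injective f := fun a b hab =>
      Subtype.ext (by rw [← hf a, ← hf b, hab])
    simpa using Nat.card_le_card_of_injective f hinj
  unfold Generator.k
  omega

theorem annularFiltration_eq_bot {i : ℤ} (hi : i < -(n : ℤ)) : w.annularFiltration i = ⊥ := by
  have h : {x : Generator w | x.k ≤ i} = ∅ :=
    Set.eq_empty_of_forall_notMem fun x hx => absurd (x.neg_le_k.trans hx) (not_le.2 hi)
  rw [annularFiltration, h, Finsupp.supported_empty]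

theorem left_ne_right (w : BraidWord n) (t : Fin w.length) : w.left t ≠ w.right t := by
  simp [left, right, Fin.ext_iff]

/-- The strand position of a circle of the braidlike resolution. -/
def braidlikePosition (w : BraidWord n) : Circle w w.braidlikeResolution → Fin n :=
  Quot.lift Prod.fst fun p q h => by
    cases h with
    | cap t h => exact absurd rfl h
    | cup t h => exact absurd rfl h
    | _ => rfl

theorem fst_eq_of_circleAt_braidlike_eq {p q : Point w}
    (h : w.circleAt w.braidlikeResolution p = w.circleAt w.braidlikeResolution q) :
    p.1 = q.1 :=
  congrArg w.braidlikePosition h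

/-- A braidlike circle stays in one strand position, so it meets level `0` exactly once. -/
theorem nontrivial_circleAt_braidlike (j : Fin n) :
    (w.circleAt w.braidlikeResolution (j, 0)).Nontrivial := by
  have h : Nat.card {i : Fin n //
      w.circleAt w.braidlikeResolution (i, 0) = w.circleAt w.braidlikeResolution (j, 0)} = 1 :=
    Nat.card_eq_one_iff_unique.2
      ⟨⟨fun a b => Subtype.ext ((fst_eq_of_circleAt_braidlike_eq a.2).trans
        (fst_eq_of_circleAt_braidlike_eq b.2).symm)⟩, ⟨⟨j, rfl⟩⟩⟩
  rw [Circle.Nontrivial, h]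
  exact odd_one

theorem k_braidlike_minus_le (w : BraidWord n) :
    Generator.k (w := w) ⟨w.braidlikeResolution, fun _ => .minus⟩ ≤ -(n : ℤ) := by
  have hp : Nat.card {c : Circle w w.braidlikeResolution //
      c.Nontrivial ∧ Label.minus = .plus} = 0 := by simp
  have hm : n ≤ Nat.card {c : Circle w w.braidlikeResolution //
      c.Nontrivial ∧ Label.minus = .minus} := by
    have hinj : Function.Injective
        (fun j : Fin n => (⟨w.circleAt w.braidlikeResolution (j, 0),
          nontrivial_circleAt_braidlike j, rfl⟩ : {c : Circle w w.braidlikeResolution //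
            c.Nontrivial ∧ Label.minus = .minus})) := fun a b h =>
      fst_eq_of_circleAt_braidlike_eq (congrArg Subtype.val h)
    simpa using Nat.card_le_card_of_injective _ hinj
  unfold Generator.k
  dsimp only
  omega

theorem psi_mem_annularFiltration (w : BraidWord n) :
    w.psi ∈ w.annularFiltration (-(n : ℤ)) :=
  Finsupp.single_mem_supported _ _ w.k_braidlike_minus_le

/-- The two arcs at a crossing lie in different strand positions, so every edge out of the braidlike
resolution is a merge, and `m(v_- ⊗ v_-) = 0`. -/
theorem not_edgeTerm_braidlike_minus (t : Fin w.length) (y : Generator w) :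
    ¬ EdgeTerm t ⟨w.braidlikeResolution, fun _ => .minus⟩ y := by
  intro h
  have hne : w.firstCircle w.braidlikeResolution t ≠
      w.secondCircle w.braidlikeResolution t := by
    rw [firstCircle, secondCircle, if_pos rfl]
    exact fun e => w.left_ne_right t (fst_eq_of_circleAt_braidlike_eq e)
  nomatch h.merge hne

/-- The element `ψ` is a cycle. -/
theorem khovanovD_psi (w : BraidWord n) : w.khovanovD w.psi = 0 := by
  simp [khovanovD, psi, not_edgeTerm_braidlike_minus]

/-- If `ψ` is a boundary in `F_{m-n}` but not in `F_{m-1-n}`, then `d^m` is nonzero. -/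
theorem pageDifferentialNonzero_of_psi_mem {m : ℕ}
    (hm : w.psi ∈ (w.annularFiltration ((m : ℤ) - n)).map w.khovanovD)
    (hm' : w.psi ∉ (w.annularFiltration ((m : ℤ) - 1 - n)).map w.khovanovD) :
    PageDifferentialNonzero w.khovanovD w.annularFiltration m := by
  obtain ⟨y, hy, hdy⟩ := hm
  have hp : (m : ℤ) - n - m = -n := by ring
  have hψ : w.khovanovD y ∈ w.annularFiltration ((m : ℤ) - n - m) := by
    rw [hdy, hp]
    exact w.psi_mem_annularFiltration
  refine ⟨(m : ℤ) - n, y, ⟨hy, hψ⟩, ⟨hψ, ?_⟩, fun h => hm' ?_⟩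
  · change w.khovanovD (w.khovanovD y) ∈ w.annularFiltration _
    rw [hdy, khovanovD_psi]
    exact zero_mem _
  · have h' := (Submodule.Quotient.mk_eq_zero _).1 h
    change w.khovanovD y ∈ pageBoundaries _ _ _ _ at h'
    -- At filtration degree `-n` the summand `F_{-n-1}` vanishes, leaving only boundaries from
    -- `F_{m-1-n}`.
    rw [pageBoundaries, annularFiltration_eq_bot (by omega), bot_sup_eq, hdy, hp,
      show -(n : ℤ) + m - 1 = m - 1 - n by ring] at h'
    exact h'

end BraidWord

theorem mainTheorem9 (n : ℕ) (w : BraidWord n) (hw : w.kappa ≠ ⊤) :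
    w.kappa ≤ w.annularLength := by
  classical
  have hex : ∃ m : ℕ, w.psi ∈ (w.annularFiltration ((m : ℤ) - n)).map w.khovanovD := by
    by_contra! h
    exact hw (by simp [BraidWord.kappa, h])
  have hle : w.kappa ≤ (Nat.find hex : ℕ∞) :=
    iInf₂_le (Nat.find hex) (Nat.find_spec hex)
  refine hle.trans ?_
  -- The length only counts `r ≥ 1`, so a minimum of `0` is treated apart; the bound is then
  -- trivial.
  rcases Nat.eq_zero_or_pos (Nat.find hex) with h0 | hpos
  · rw [h0, Nat.cast_zero]
    exact zero_le
  · have hmin := Nat.find_min hex (Nat.sub_lt hpos one_pos)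
    rw [Nat.cast_pred hpos] at hmin
    exact le_iSup₂_of_le (Nat.find hex) hpos (le_iSup_of_le
      (BraidWord.pageDifferentialNonzero_of_psi_mem (Nat.find_spec hex) hmin) le_rfl)
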